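/- Let $m\ge 1$, $L>0$, and let $f:\mathbb R^m\to\mathbb R$ be convex and differentiable with $|f(x)-f(y)-\langle\nabla f(y),x-y\rangle|\le \frac L2\|x-y\|_2^2$ for all $x,y\in\mathbb R^m$ (that is, $\nabla f$ is $L$-Lipschitz). Let $x^*$ be a minimizer of $f$ on $\mathbb R^m$ and $f^*=f(x^*)$. Suppose that only an inexact zeroth-order oracle is available, which returns $f^\delta(x)=f(x)+\tilde\delta(x)$, where $\tilde\delta:\mathbb R^m\to\mathbb R$ is measurable and $|\tilde\delta(x)|\le\delta$ for all $x$. Let $x_0\in\mathbb R^m$, let $R$ satisfy $\|x_0-x^*\|_2\le R$, let $\mu>0$, $h=\frac1{8mL}$ and $X=\{x\in\mathbb R^m:\|x-x_0\|_2\le 2R\}$. Let $s_0,s_1,\dots$ be independent random vectors uniformly distributed over the unit sphere $\{t\in\mathbb R^m:\|t\|_2=1\}$, and define $$x_{k+1}=\Pi_X\bigl(x_k-h\,g_\mu^\delta(x_k)\bigr),\qquad g_\mu^\delta(x_k)=\frac m\mu\bigl(f^\delta(x_k+\mu s_k)-f^\delta(x_k)\bigr)s_k,\qquad k\ge 0,$$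 where $\Pi_X$ is the Euclidean projection onto $X$. Put $\psi_k=\mathbb E f(x_k)$ (all these expectations are well defined and finite; $\psi_0=f(x_0)$). Then for every integer $M\ge 0$ $$\frac1{M+1}\sum_{i=0}^M(\psi_i-f^*)\le\frac{8mLR^2}{M+1}+\frac{\mu^2L(m+8)}8+\frac{8\delta mR}\mu+\frac{\delta^2m}{L\mu^2}.$$ If, moreover, $f$ is strongly convex with parameter $\tau>0$, i.e. $f(x)\ge f(y)+\langle\nabla f(y),x-y\rangle+\frac\tau2\|x-y\|_2^2$ for all $x,y\in\mathbb R^m$, then for every integer $M\ge 0$ $$\psi_M-f^*\le\frac12L\left(\delta_\mu+\Bigl(1-\frac\tau{16mL}\Bigr)^M(R^2-\delta_\mu)\right),\qquad \delta_\mu=\frac{\mu^2L(m+8)}{4\tau}+\frac{16m\delta R}{\tau\mu}+\frac{2m\delta^2}{\tau\mu^2L}.$$ -/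

import Mathlib

open MeasureTheory ProbabilityTheory

namespace GradFree

/-- The Euclidean space `ℝ^m`. -/
abbrev E (m : ℕ) : Type := EuclideanSpace ℝ (Fin m)

/-- The class `C^{1,1}_L`: `f` is differentiable and its gradient is Lipschitz with constant `L`,
in the form `|f(x) - f(y) - ⟨∇f(y), x - y⟩| ≤ (L/2) ‖x - y‖²` for all `x, y`. -/
def IsC11 {m : ℕ} (L : ℝ) (f : E m → ℝ) : Prop :=
  Differentiable ℝ f ∧
    ∀ x y : E m, |f x - f y - inner ℝ (gradient f y) (x - y)| ≤ L / 2 * ‖x - y‖ ^ 2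

/-- Strong convexity with parameter `τ` of a smooth function, in gradient form. -/
def IsStronglyConvex {m : ℕ} (τ : ℝ) (f : E m → ℝ) : Prop :=
  ∀ x y : E m, f y + inner ℝ (gradient f y) (x - y) + τ / 2 * ‖x - y‖ ^ 2 ≤ f x

/-- The uniform probability distribution on the Euclidean unit sphere of `ℝ^m`, as a measure
on `ℝ^m`: the normalized surface measure. -/
noncomputable def uniformSphere (m : ℕ) : Measure (E m) :=
  ((volume : Measure (E m)).toSphere Set.univ)⁻¹ •
    ((volume : Measure (E m)).toSphere).map Subtype.val

/-- The biased gradient-free oracle `(m/μ) (f^δ(x + μ s) - f^δ(x)) s`, where `fd` is the function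
`f^δ` returned by the inexact zeroth-order oracle and `s` is the random direction. -/
noncomputable def oracle {m : ℕ} (fd : E m → ℝ) (μ : ℝ) (x s : E m) : E m :=
  ((m : ℝ) / μ * (fd (x + μ • s) - fd x)) • s

/-- `p` is a Euclidean projection of `z` onto `X`. -/
def IsProj {m : ℕ} (X : Set (E m)) (z p : E m) : Prop :=
  p ∈ X ∧ ∀ y ∈ X, ‖z - p‖ ≤ ‖z - y‖

/-- The Euclidean projection `Π_X(z)`. -/
noncomputable def euclProj {m : ℕ} (X : Set (E m)) (z : E m) : E m :=
  Classical.epsilon (IsProj X z)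

/-- On nonempty closed sets (so in particular on closed balls) `euclProj` is indeed a nearest
point. -/
theorem euclProj_spec {m : ℕ} {X : Set (E m)} (hX : IsClosed X) (hne : X.Nonempty) (z : E m) :
    IsProj X z (euclProj X z) := by
  apply Classical.epsilon_spec (p := IsProj X z)
  obtain ⟨p, hp, hd⟩ := hX.exists_infDist_eq_dist hne z
  refine ⟨p, hp, fun y hy => ?_⟩
  rw [← dist_eq_norm, ← dist_eq_norm, ← hd]
  exact Metric.infDist_le_dist_of_mem hy

/-- The iterates `x_0, x_1, …` of the projected gradient-free method with starting point `x0`,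
radius `R`, step size `h` and smoothing parameter `μ`, for the realization `u 0, u 1, …` of the
random directions: `x_{k+1} = Π_X(x_k - h g(x_k))` with `X = {x : ‖x - x0‖ ≤ 2R}`. -/
noncomputable def iterates {m : ℕ} (fd : E m → ℝ) (μ h R : ℝ) (x0 : E m) (u : ℕ → E m) :
    ℕ → E m
  | 0 => x0
  | k + 1 =>
      euclProj (Metric.closedBall x0 (2 * R))
        (iterates fd μ h R x0 u k - h • oracle fd μ (iterates fd μ h R x0 u k) (u k))

/-- The constant `δ_μ` of the strongly convex estimate. -/
noncomputable def deltaMu (m : ℕ) (L R τ μ δ : ℝ) : ℝ :=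
  μ ^ 2 * L * (m + 8) / (4 * τ) + 16 * m * δ * R / (τ * μ) + 2 * m * δ ^ 2 / (τ * μ ^ 2 * L)

end GradFree

namespace GradFree

open Set Metric

/-! The analysis rests on one inequality, `le_uniformSphere_integral`: on average over the sphere,
`(m/μ) f(x + μs) s` acts at `x` like a subgradient of `f`, up to a loss `Lμ²/2`. Classically this
vector is the gradient of the average of `f` over the ball of radius `μ`, and that average is convex
and close to `f`. Here the divergence theorem on the ball is replaced by integration by parts
against a smooth radial cut-off `Φ(‖b‖²)` (`integral_mul_radial_le`). Polar coordinates and a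
cut-off whose derivative concentrates near radius `μ` then recover the sphere
(`le_sphere_integral`).

The same inequality, applied to constant and to linear functions, gives the first and second moments
of the uniform law. With nonexpansiveness of the projection and `‖∇f‖² ≤ 2L(f - f*)`, one step
(`integral_step_le`) lowers the mean squared distance to the minimizer by `h(f - f*)` up to `h *
stepError`. Since `s k` is independent of the iterate `x k`, Fubini turns this into a recursion for
`D k = E‖x k - x*‖²`. Telescoping it gives the averaged bound. Under strong convexity it is an
affine contraction, and `f - f* ≤ (L/2)‖x - x*‖²` converts distances back to values. -/

/-! ### Polar coordinates, radial cut-offs and the gradient inequality. -/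

theorem integral_eq_integral_Ioi_sphere {m : ℕ} (hm : 1 ≤ m) {G : E m → ℝ} (hG : Integrable G) :
    ∫ x, G x = ∫ r in Ioi (0 : ℝ), r ^ (m - 1) *
      ∫ σ : sphere (0 : E m) 1, G (r • (σ : E m)) ∂(volume : Measure (E m)).toSphere := by
  have hne : Nontrivial (E m) := by
    have : NeZero m := ⟨by omega⟩
    infer_instance
  have hmp := (volume : Measure (E m)).measurePreserving_homeomorphUnitSphereProd
  have hemb : MeasurableEmbedding (homeomorphUnitSphereProd (E m)) :=
    (homeomorphUnitSphereProd (E m)).measurableEmbedding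
  have hval : ∀ x : ({0}ᶜ : Set (E m)),
      G x = (fun p : sphere (0 : E m) 1 × Ioi (0 : ℝ) => G (p.2.1 • p.1.1))
        (homeomorphUnitSphereProd (E m) x) := by
    intro x
    have : ‖(x : E m)‖ ≠ 0 := norm_ne_zero_iff.mpr x.2
    simp [homeomorphUnitSphereProd, smul_smul, this]
  have hdim : Module.finrank ℝ (E m) = m := by simp
  rw [hdim] at hmp
  have hint : Integrable (fun p : sphere (0 : E m) 1 × Ioi (0 : ℝ) => G (p.2.1 • p.1.1))
      ((volume : Measure (E m)).toSphere.prod (Measure.volumeIoiPow (m - 1))) := by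
    rw [← hmp.integrable_comp_emb hemb]
    refine Integrable.congr ?_ (Filter.Eventually.of_forall hval)
    exact (integrableOn_iff_comap_subtypeVal (measurableSet_singleton (0 : E m)).compl).mp
      hG.integrableOn
  calc ∫ x, G x = ∫ x : ({0}ᶜ : Set (E m)), G x ∂((volume : Measure (E m)).comap Subtype.val) := by
        rw [integral_subtype_comap (measurableSet_singleton (0 : E m)).compl,
          restrict_compl_singleton]
    _ = ∫ p, (fun p : sphere (0 : E m) 1 × Ioi (0 : ℝ) => G (p.2.1 • p.1.1)) p
          ∂((volume : Measure (E m)).toSphere.prod (Measure.volumeIoiPow (m - 1))) := by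
        rw [← hmp.integral_comp hemb]
        exact integral_congr_ae (Filter.Eventually.of_forall hval)
    _ = ∫ r : Ioi (0 : ℝ), ∫ σ : sphere (0 : E m) 1, G (r.1 • (σ : E m))
          ∂(volume : Measure (E m)).toSphere ∂(Measure.volumeIoiPow (m - 1)) :=
        integral_prod_symm _ hint
    _ = ∫ r in Ioi (0 : ℝ), r ^ (m - 1) *
          ∫ σ : sphere (0 : E m) 1, G (r • (σ : E m)) ∂(volume : Measure (E m)).toSphere := by
        simp only [Measure.volumeIoiPow, ENNReal.ofReal]
        rw [integral_withDensity_eq_integral_smul,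
          integral_subtype_comap measurableSet_Ioi fun a : ℝ => Real.toNNReal (a ^ (m - 1)) •
            ∫ σ : sphere (0 : E m) 1, G (a • (σ : E m)) ∂(volume : Measure (E m)).toSphere]
        · refine setIntegral_congr_fun measurableSet_Ioi fun r hr => ?_
          simp only [NNReal.smul_def, smul_eq_mul]
          rw [Real.coe_toNNReal _ (pow_nonneg (le_of_lt hr) _)]
        · exact (measurable_subtype_coe.pow_const _).real_toNNReal

theorem exists_smooth_step {A B : ℝ} (hAB : A < B) :
    ∃ Φ : ℝ → ℝ, ContDiff ℝ 1 Φ ∧ (∀ t, 0 ≤ Φ t) ∧ (∀ t ≤ A, Φ t = 1) ∧ (∀ t, B ≤ t → Φ t = 0) ∧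
      (∀ t, deriv Φ t ≤ 0) ∧ (∀ t, t < A → deriv Φ t = 0) ∧ (∀ t, B < t → deriv Φ t = 0) := by
  have hpos : 0 < B - A := sub_pos.mpr hAB
  have hone : ∀ t ≤ A, Real.smoothTransition ((B - t) / (B - A)) = 1 := fun t ht =>
    Real.smoothTransition.one_of_one_le ((one_le_div hpos).mpr (by linarith))
  have hzero : ∀ t, B ≤ t → Real.smoothTransition ((B - t) / (B - A)) = 0 := fun t ht =>
    Real.smoothTransition.zero_of_nonpos (div_nonpos_of_nonpos_of_nonneg (by linarith) hpos.le)
  refine ⟨fun t => Real.smoothTransition ((B - t) / (B - A)), ?_,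
    fun t => Real.smoothTransition.nonneg _, hone, hzero, fun t => ?_, fun t ht => ?_,
    fun t ht => ?_⟩
  · exact (Real.smoothTransition.contDiff (n := 1)).comp (by fun_prop)
  · refine Antitone.deriv_nonpos fun a b hab => Real.smoothTransition.monotone ?_
    gcongr
  · refine Filter.EventuallyEq.deriv_eq (f := fun _ => (1 : ℝ)) ?_ |>.trans (by simp)
    filter_upwards [Iio_mem_nhds ht] with u hu using hone u (le_of_lt hu)
  · refine Filter.EventuallyEq.deriv_eq (f := fun _ => (0 : ℝ)) ?_ |>.trans (by simp)
    filter_upwards [Ioi_mem_nhds ht] with u hu using hzero u (le_of_lt hu)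

theorem _root_.ConvexOn.add_fderiv_le {V : Type*} [NormedAddCommGroup V] [NormedSpace ℝ V]
    {f : V → ℝ} (hconv : ConvexOn ℝ univ f) {x : V} (hd : DifferentiableAt ℝ f x) (y : V) :
    f x + fderiv ℝ f x (y - x) ≤ f y := by
  have hφ : ConvexOn ℝ univ (fun t : ℝ => f (AffineMap.lineMap x y t)) :=
    hconv.comp_affineMap (AffineMap.lineMap x y)
  have hder : HasDerivAt (fun t : ℝ => f (AffineMap.lineMap x y t)) (fderiv ℝ f x (y - x)) 0 := by
    have h1 : HasFDerivAt f (fderiv ℝ f x) (AffineMap.lineMap x y (0 : ℝ)) := by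
      simpa using hd.hasFDerivAt
    exact h1.comp_hasDerivAt (0 : ℝ) AffineMap.hasDerivAt_lineMap
  have := hφ.le_slope_of_hasDerivAt (mem_univ 0) (mem_univ 1) zero_lt_one hder
  simp only [slope_def_field, AffineMap.lineMap_apply_one, AffineMap.lineMap_apply_zero, sub_zero,
    div_one] at this
  linarith

theorem hasCompactSupport_radial {m : ℕ} {Φ : ℝ → ℝ} {B : ℝ} (hB : ∀ t, B < t → Φ t = 0) :
    HasCompactSupport (fun b : E m => Φ (‖b‖ ^ 2)) := by
  refine HasCompactSupport.of_support_subset_isCompact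
    -- Outside this ball `‖b‖² > (1 + |B|)² ≥ B`, whatever the sign of `B`.
    (isCompact_closedBall (0 : E m) (1 + |B|)) fun b hb => ?_
  rw [mem_closedBall_zero_iff]
  by_contra h
  push Not at h
  refine hb (hB _ ?_)
  nlinarith [le_abs_self B, abs_nonneg B]

theorem integral_inner_mul_radial {m : ℕ} (Φ : ℝ → ℝ) (a : E m) :
    ∫ b : E m, inner ℝ a b * Φ (‖b‖ ^ 2) = 0 := by
  have h := integral_neg_eq_self (fun b : E m => inner ℝ a b * Φ (‖b‖ ^ 2)) volume
  simp only [inner_neg_right, norm_neg, neg_mul, integral_neg] at h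
  linarith

/-! ### The sphere inequality for convex functions. -/

/-- Convexity at `x + b` and at `x`, with the quadratic upper bound at `y`, gives `f'(x+b)(x-y) ≥ f
x - f y - (L/2)‖b‖²` plus a term linear in `b`. Weighted by a radial function the linear term
integrates to zero by oddness, and integration by parts moves the derivative onto `Φ`. The
dominating function `G` makes the derivative term integrable without continuity of `fderiv`. -/
theorem integral_mul_radial_le {m : ℕ} {f : E m → ℝ} (hconv : ConvexOn ℝ univ f)
    (hd : Differentiable ℝ f) {G : E m → ℝ} (hGc : Continuous G) (hG : ∀ y, ‖fderiv ℝ f y‖ ≤ G y)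
    (x y g : E m) {L : ℝ} (hup : ∀ b, f (y + b) ≤ f y + inner ℝ g b + L / 2 * ‖b‖ ^ 2)
    {Φ : ℝ → ℝ} (hΦ : ContDiff ℝ 1 Φ) (hΦ0 : ∀ t, 0 ≤ Φ t) {B : ℝ} (hB : ∀ t, B ≤ t → Φ t = 0) :
    ∫ b : E m, (f x - f y - L / 2 * ‖b‖ ^ 2) * Φ (‖b‖ ^ 2) ≤
      ∫ b : E m, f (x + b) * (-2 * inner ℝ b (x - y) * deriv Φ (‖b‖ ^ 2)) := by
  set a := gradient f x
  have hΦc : Continuous Φ := hΦ.continuous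
  have hΦ'c : Continuous (deriv Φ) := hΦ.continuous_deriv le_rfl
  have hfc : Continuous f := hd.continuous
  have hB' : ∀ t, B < t → deriv Φ t = 0 := fun t ht => by
    refine Filter.EventuallyEq.deriv_eq (f := fun _ => (0 : ℝ)) ?_ |>.trans (by simp)
    filter_upwards [Ioi_mem_nhds ht] with u hu using hB u (le_of_lt hu)
  have hcs : HasCompactSupport (fun b : E m => Φ (‖b‖ ^ 2)) :=
    hasCompactSupport_radial fun t ht => hB t ht.le
  have hcs' : HasCompactSupport (fun b : E m => deriv Φ (‖b‖ ^ 2)) := hasCompactSupport_radial hB'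
  have hder : ∀ b : E m, HasFDerivAt (fun b : E m => Φ (‖b‖ ^ 2))
      (deriv Φ (‖b‖ ^ 2) • (2 • (innerSL ℝ b))) b := fun b =>
    ((hΦ.differentiable one_ne_zero).differentiableAt.hasDerivAt).comp_hasFDerivAt b
      (hasStrictFDerivAt_norm_sq b).hasFDerivAt
  have hder' : ∀ b : E m, fderiv ℝ (fun b : E m => Φ (‖b‖ ^ 2)) b (x - y) =
      2 * inner ℝ b (x - y) * deriv Φ (‖b‖ ^ 2) := fun b => by
    rw [(hder b).fderiv]
    simp
    ring
  have hfd : ∀ b, fderiv ℝ (fun b => f (x + b)) b (x - y) = fderiv ℝ f (x + b) (x - y) := fun b => by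
    rw [fderiv_comp_add_left]
  have hint1 : Integrable fun b : E m => fderiv ℝ (fun b => f (x + b)) b (x - y) * Φ (‖b‖ ^ 2) := by
    have hc : Integrable fun b : E m => G (x + b) * ‖x - y‖ * Φ (‖b‖ ^ 2) :=
      Continuous.integrable_of_hasCompactSupport (by fun_prop) hcs.mul_left
    refine hc.mono' ?_ (Filter.Eventually.of_forall fun b => ?_)
    · exact ((measurable_fderiv_apply_const ℝ _ _).mul (by fun_prop)).aestronglyMeasurable
    · rw [hfd, norm_mul, Real.norm_of_nonneg (hΦ0 _)]
      gcongr
      · exact hΦ0 _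
      · exact ((fderiv ℝ f (x + b)).le_opNorm _).trans (by gcongr; exact hG _)
  have hibp := integral_mul_fderiv_eq_neg_fderiv_mul_of_integrable (μ := (volume : Measure (E m)))
    (f := fun b => f (x + b)) (g := fun b : E m => Φ (‖b‖ ^ 2)) (v := x - y) hint1
    (by
      simp only [hder']
      exact Continuous.integrable_of_hasCompactSupport (by fun_prop) hcs'.mul_left.mul_left)
    (Continuous.integrable_of_hasCompactSupport (by fun_prop) hcs.mul_left)
    (fun b _ => by fun_prop) (fun b _ => (hder b).differentiableAt)
  have hlin : ∫ b : E m, (f x + inner ℝ a b - (f y + inner ℝ g b + L / 2 * ‖b‖ ^ 2)) * Φ (‖b‖ ^ 2) =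
      ∫ b : E m, (f x - f y - L / 2 * ‖b‖ ^ 2) * Φ (‖b‖ ^ 2) := by
    rw [← sub_eq_zero, ← integral_sub]
    · rw [← integral_inner_mul_radial Φ (a - g)]
      congr 1 with b
      rw [inner_sub_left]
      ring
    · exact Continuous.integrable_of_hasCompactSupport (by fun_prop) hcs.mul_left
    · exact Continuous.integrable_of_hasCompactSupport (by fun_prop) hcs.mul_left
  rw [← hlin]
  have hrhs : ∫ b : E m, f (x + b) * (-2 * inner ℝ b (x - y) * deriv Φ (‖b‖ ^ 2)) =
      ∫ b : E m, fderiv ℝ (fun b => f (x + b)) b (x - y) * Φ (‖b‖ ^ 2) := by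
    rw [← neg_eq_iff_eq_neg.mpr hibp, ← integral_neg]
    congr 1 with b
    rw [hder']
    ring
  rw [hrhs]
  refine integral_mono
    (Continuous.integrable_of_hasCompactSupport (by fun_prop) hcs.mul_left) hint1 fun b => ?_
  refine mul_le_mul_of_nonneg_right ?_ (hΦ0 _)
  rw [hfd]
  have h1 := hconv.add_fderiv_le (hd (x + b)) (y + b)
  have h2 := hconv.add_fderiv_le (hd x) (x + b)
  have h3 : fderiv ℝ f x b = inner ℝ a b := by
    simp [a, gradient]
  rw [show y + b - (x + b) = -(x - y) by abel, map_neg] at h1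
  rw [add_sub_cancel_left, h3] at h2
  linarith [hup b]

theorem continuous_sphere_integral {m : ℕ} {f : E m → ℝ} (hf : Continuous f) (x v : E m) :
    Continuous fun r : ℝ => ∫ σ : sphere (0 : E m) 1, f (x + r • (σ : E m)) * inner ℝ (σ : E m) v
      ∂(volume : Measure (E m)).toSphere := by
  have := continuous_parametric_integral_of_continuous
    (f := fun (r : ℝ) (σ : sphere (0 : E m) 1) => f (x + r • (σ : E m)) * inner ℝ (σ : E m) v)
    (μ := (volume : Measure (E m)).toSphere) (by fun_prop) isCompact_univ
  simpa using this

theorem hasCompactSupport_comp_sq {Φ : ℝ → ℝ} {B : ℝ} (hB : ∀ t, B < t → Φ t = 0) :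
    HasCompactSupport (fun r : ℝ => Φ (r ^ 2)) := by
  refine HasCompactSupport.of_support_subset_isCompact
    (isCompact_closedBall (0 : ℝ) (1 + |B|)) fun b hb => ?_
  rw [mem_closedBall_zero_iff, Real.norm_eq_abs]
  by_contra h
  push Not at h
  refine hb (hB _ ?_)
  rw [← sq_abs]
  nlinarith [le_abs_self B, abs_nonneg B]

/-- The integrand is the derivative of `p r * Φ (r ^ 2)`, which vanishes for large `r`. It serves
twice below: with the radial primitive of the lower bound, and with `p = 1` to find the total mass
of the derivative of the cut-off. -/
theorem integral_Ioi_deriv_mul_comp_sq {p p' : ℝ → ℝ} (hp : ∀ r, HasDerivAt p (p' r) r)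
    (hp' : Continuous p') {Φ : ℝ → ℝ} (hΦ : ContDiff ℝ 1 Φ) {B : ℝ} (hB : ∀ t, B ≤ t → Φ t = 0) :
    ∫ r in Ioi (0 : ℝ), (p' r * Φ (r ^ 2) + p r * (2 * r * deriv Φ (r ^ 2))) = -(p 0 * Φ 0) := by
  have hΦc : Continuous Φ := hΦ.continuous
  have hΦ'c : Continuous (deriv Φ) := hΦ.continuous_deriv le_rfl
  have hpc : Continuous p := continuous_iff_continuousAt.mpr fun r => (hp r).continuousAt
  have hB' : ∀ t, B < t → deriv Φ t = 0 := fun t ht => by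
    refine Filter.EventuallyEq.deriv_eq (f := fun _ => (0 : ℝ)) ?_ |>.trans (by simp)
    filter_upwards [Ioi_mem_nhds ht] with u hu using hB u (le_of_lt hu)
  have hcs : HasCompactSupport (fun r : ℝ => Φ (r ^ 2)) :=
    hasCompactSupport_comp_sq fun t ht => hB t ht.le
  have hcs' : HasCompactSupport (fun r : ℝ => deriv Φ (r ^ 2)) := hasCompactSupport_comp_sq hB'
  have hder : ∀ r : ℝ, HasDerivAt (fun r => p r * Φ (r ^ 2))
      (p' r * Φ (r ^ 2) + p r * (2 * r * deriv Φ (r ^ 2))) r := fun r => by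
    have h1 : HasDerivAt (fun r : ℝ => Φ (r ^ 2)) (deriv Φ (r ^ 2) * (2 * r)) r := by
      have := ((hΦ.differentiable one_ne_zero).differentiableAt (x := r ^ 2)).hasDerivAt.comp r
        (hasDerivAt_pow 2 r)
      exact this.congr_deriv (by simp)
    exact ((hp r).mul h1).congr_deriv (by ring)
  have hcp : HasCompactSupport (fun r => p r * Φ (r ^ 2)) := hcs.mul_left
  rw [integral_Ioi_of_hasDerivAt_of_tendsto' (fun r _ => hder r) ?_
    (hcp.is_zero_at_infty.mono_left atTop_le_cocompact)]
  · simp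
  · refine (Continuous.integrable_of_hasCompactSupport (by fun_prop) ?_).integrableOn
    exact hcs.mul_left.add hcs'.mul_left.mul_left

/-- With `w r` the right side minus the left side at radius `r`, the cut-off inequality says that `w
r * r ^ (m - 1)` has nonnegative mean against the density `-2 r Φ'(r²)`. That density has mass one
and can be concentrated around `μ`, so continuity of `w` excludes `w μ < 0`. -/
theorem le_sphere_integral {m : ℕ} (hm : 1 ≤ m) {f : E m → ℝ} (hconv : ConvexOn ℝ univ f)
    (hd : Differentiable ℝ f) {G : E m → ℝ} (hGc : Continuous G) (hG : ∀ y, ‖fderiv ℝ f y‖ ≤ G y)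
    (x y g : E m) {L : ℝ} (hup : ∀ b, f (y + b) ≤ f y + inner ℝ g b + L / 2 * ‖b‖ ^ 2)
    {μ : ℝ} (hμ : 0 < μ) :
    (volume : Measure (E m)).toSphere.real univ *
        ((f x - f y) * μ / m - L * μ ^ 3 / (2 * (m + 2))) ≤
      ∫ σ : sphere (0 : E m) 1, f (x + μ • (σ : E m)) * inner ℝ (σ : E m) (x - y)
        ∂(volume : Measure (E m)).toSphere := by
  set S := (volume : Measure (E m)).toSphere.real univ with hS
  set q : ℝ → ℝ := fun r => ∫ σ : sphere (0 : E m) 1,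
    f (x + r • (σ : E m)) * inner ℝ (σ : E m) (x - y) ∂(volume : Measure (E m)).toSphere with hq
  set w : ℝ → ℝ := fun r => q r - S * ((f x - f y) * r / m - L * r ^ 3 / (2 * (m + 2))) with hw
  have hqc : Continuous q := continuous_sphere_integral hd.continuous x (x - y)
  have hwc : Continuous w := by fun_prop
  suffices 0 ≤ w μ by simpa [hw] using this
  by_contra! hneg
  obtain ⟨ε, hε, hεw⟩ : ∃ ε > 0, ∀ r, |r - μ| < ε → w r < w μ / 2 := by
    have := hwc.continuousAt (x := μ) |>.eventually (Iio_mem_nhds (show w μ < w μ / 2 by linarith))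
    rw [Metric.eventually_nhds_iff] at this
    simpa [Real.dist_eq] using this
  -- This keeps `[μ - η, μ + η]` inside the `ε`-neighbourhood of `μ` and inside the positive
  -- half-line.
  set η := min ε μ / 2 with hη
  have hη0 : 0 < η := by positivity
  have hηε : η < ε := by linarith [min_le_left ε μ]
  have hημ : η < μ := by linarith [min_le_right ε μ]
  obtain ⟨Φ, hΦ, hΦ0, hΦ1, hB, hmono, hdA, hdB⟩ :=
    exists_smooth_step (A := (μ - η) ^ 2) (B := (μ + η) ^ 2) (by nlinarith)
  have hΦc : Continuous Φ := hΦ.continuous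
  have hΦ'c : Continuous (deriv Φ) := hΦ.continuous_deriv le_rfl
  have hfc := hd.continuous
  have hm0 : (m : ℝ) ≠ 0 := by positivity
  have hrad := integral_mul_radial_le hconv hd hGc hG x y g hup hΦ hΦ0 hB
  have hcs : HasCompactSupport (fun b : E m => Φ (‖b‖ ^ 2)) :=
    hasCompactSupport_radial fun t ht => hB t ht.le
  have hcs' : HasCompactSupport (fun b : E m => deriv Φ (‖b‖ ^ 2)) := hasCompactSupport_radial hdB
  have hcs1 : HasCompactSupport (fun r : ℝ => Φ (r ^ 2)) :=
    hasCompactSupport_comp_sq fun t ht => hB t ht.le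
  have hcs1' : HasCompactSupport (fun r : ℝ => deriv Φ (r ^ 2)) := hasCompactSupport_comp_sq hdB
  have hE1 : Integrable fun b : E m => (f x - f y - L / 2 * ‖b‖ ^ 2) * Φ (‖b‖ ^ 2) :=
    Continuous.integrable_of_hasCompactSupport (by fun_prop) hcs.mul_left
  have hE2 : Integrable fun b : E m =>
      f (x + b) * (-2 * inner ℝ b (x - y) * deriv Φ (‖b‖ ^ 2)) :=
    Continuous.integrable_of_hasCompactSupport (by fun_prop) hcs'.mul_left.mul_left
  rw [integral_eq_integral_Ioi_sphere hm hE1, integral_eq_integral_Ioi_sphere hm hE2] at hrad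
  have hnorm : ∀ r : ℝ, ∀ σ : sphere (0 : E m) 1, ‖r • (σ : E m)‖ ^ 2 = r ^ 2 := fun r σ => by
    simp [norm_smul]
  have hr1 : ∀ r : ℝ, r ^ (m - 1) * ∫ σ : sphere (0 : E m) 1,
      f (x + r • (σ : E m)) * (-2 * inner ℝ (r • (σ : E m)) (x - y) *
        deriv Φ (r ^ 2)) ∂(volume : Measure (E m)).toSphere =
      r ^ (m - 1) * (-2 * r * deriv Φ (r ^ 2)) * q r := fun r => by
    rw [mul_assoc]
    congr 1
    simp only [hq]
    rw [← integral_const_mul]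
    refine integral_congr_ae (Filter.Eventually.of_forall fun σ => ?_)
    simp only [real_inner_smul_left]
    ring
  simp only [hnorm, hr1, integral_const, smul_eq_mul, ← hS] at hrad
  have hpm : ∀ r : ℝ, r ^ m = r ^ (m - 1) * r := fun r => by
    rw [← pow_succ, Nat.sub_add_cancel hm]
  have h1d := integral_Ioi_deriv_mul_comp_sq
    (p := fun r => S * ((f x - f y) * r ^ m / m - L * r ^ (m + 2) / (2 * (m + 2))))
    (p' := fun r => S * (r ^ (m - 1) * (f x - f y - L / 2 * r ^ 2))) (fun r => by
      have h := (((((hasDerivAt_pow m r).const_mul (f x - f y)).div_const (m : ℝ)).sub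
        (((hasDerivAt_pow (m + 2) r).const_mul L).div_const (2 * ((m : ℝ) + 2))))).const_mul S
      refine h.congr_deriv ?_
      have : (m : ℝ) + 2 ≠ 0 := by positivity
      rw [show m + 2 - 1 = m - 1 + 2 by omega, pow_add]
      push_cast
      field_simp) (by fun_prop) hΦ hB
  have h2d := integral_Ioi_deriv_mul_comp_sq (p := fun _ => 1) (p' := fun _ => 0)
    (fun r => hasDerivAt_const _ _) (by fun_prop) hΦ hB
  have hΦ00 : Φ 0 = 1 := hΦ1 0 (by positivity)
  -- The primitive vanishes at `0` because `m ≠ 0`, so no boundary term remains.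
  simp [show m ≠ 0 by omega] at h1d
  simp [hΦ00] at h2d
  have hI1 : IntegrableOn (fun r : ℝ => r ^ (m - 1) * (-2 * r * deriv Φ (r ^ 2)) * q r) (Ioi 0) :=
    (Continuous.integrable_of_hasCompactSupport (by fun_prop)
      hcs1'.mul_left.mul_left.mul_right).integrableOn
  have hI2 : IntegrableOn (fun r : ℝ =>
      r ^ (m - 1) * (S * ((f x - f y - L / 2 * r ^ 2) * Φ (r ^ 2)))) (Ioi 0) :=
    (Continuous.integrable_of_hasCompactSupport (by fun_prop)
      hcs1.mul_left.mul_left.mul_left).integrableOn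
  have hI12 : IntegrableOn (fun r : ℝ => r ^ (m - 1) * (-2 * r * deriv Φ (r ^ 2)) * q r -
      r ^ (m - 1) * (S * ((f x - f y - L / 2 * r ^ 2) * Φ (r ^ 2)))) (Ioi 0) := hI1.sub hI2
  have hI3 : IntegrableOn (fun r : ℝ => S * (r ^ (m - 1) * (f x - f y - L / 2 * r ^ 2)) * Φ (r ^ 2) +
      S * ((f x - f y) * r ^ m / m - L * r ^ (m + 2) / (2 * (m + 2))) * (2 * r * deriv Φ (r ^ 2)))
      (Ioi 0) :=
    (Continuous.integrable_of_hasCompactSupport (by fun_prop)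
      (hcs1.mul_left.add hcs1'.mul_left.mul_left)).integrableOn
  have hI4 : IntegrableOn (fun r : ℝ => 2 * r * deriv Φ (r ^ 2)) (Ioi 0) :=
    (Continuous.integrable_of_hasCompactSupport (by fun_prop) hcs1'.mul_left).integrableOn
  -- The last summand integrates to zero by `h1d`. Adding it cancels the `Φ` terms and leaves `-(w
  -- r) * r ^ (m - 1) * (2 * r * Φ'(r ^ 2))`.
  have hlow : 0 ≤ ∫ r in Ioi (0 : ℝ), (r ^ (m - 1) * (-2 * r * deriv Φ (r ^ 2)) * q r -
      r ^ (m - 1) * (S * ((f x - f y - L / 2 * r ^ 2) * Φ (r ^ 2))) +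
      (S * (r ^ (m - 1) * (f x - f y - L / 2 * r ^ 2)) * Φ (r ^ 2) +
      S * ((f x - f y) * r ^ m / m - L * r ^ (m + 2) / (2 * (m + 2))) *
        (2 * r * deriv Φ (r ^ 2)))) := by
    rw [integral_add hI12 hI3, integral_sub hI1 hI2, h1d]
    linarith
  have hupp : ∫ r in Ioi (0 : ℝ), (r ^ (m - 1) * (-2 * r * deriv Φ (r ^ 2)) * q r -
      r ^ (m - 1) * (S * ((f x - f y - L / 2 * r ^ 2) * Φ (r ^ 2))) +
      (S * (r ^ (m - 1) * (f x - f y - L / 2 * r ^ 2)) * Φ (r ^ 2) +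
      S * ((f x - f y) * r ^ m / m - L * r ^ (m + 2) / (2 * (m + 2))) *
        (2 * r * deriv Φ (r ^ 2)))) ≤
      ∫ r in Ioi (0 : ℝ), (-(w μ / 2) * (μ - η) ^ (m - 1)) * (2 * r * deriv Φ (r ^ 2)) := by
    refine setIntegral_mono_on (hI12.add hI3) (hI4.const_mul _) measurableSet_Ioi
      fun r hr => ?_
    have hr0 : 0 < r := hr
    have heq : (r ^ (m - 1) * (-2 * r * deriv Φ (r ^ 2)) * q r -
      r ^ (m - 1) * (S * ((f x - f y - L / 2 * r ^ 2) * Φ (r ^ 2))) +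
      (S * (r ^ (m - 1) * (f x - f y - L / 2 * r ^ 2)) * Φ (r ^ 2) +
      S * ((f x - f y) * r ^ m / m - L * r ^ (m + 2) / (2 * (m + 2))) *
        (2 * r * deriv Φ (r ^ 2)))) = (-(w r) * r ^ (m - 1)) * (2 * r * deriv Φ (r ^ 2)) := by
      rw [pow_add, hpm]
      simp only [hw]
      ring
    rw [heq]
    by_cases h1 : r < μ - η
    · rw [hdA _ (by nlinarith)]
      simp
    by_cases h2 : μ + η < r
    · rw [hdB _ (by nlinarith)]
      simp
    push Not at h1 h2
    have h3 := hεw r (by rw [abs_lt]; constructor <;> linarith)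
    refine mul_le_mul_of_nonpos_right ?_ (mul_nonpos_of_nonneg_of_nonpos (by positivity) (hmono _))
    have h4 : (μ - η) ^ (m - 1) ≤ r ^ (m - 1) := pow_le_pow_left₀ (by linarith) h1 _
    have h5 : 0 < (μ - η) ^ (m - 1) := pow_pos (by linarith) _
    nlinarith
  rw [integral_const_mul, h2d] at hupp
  have h5 : 0 < (μ - η) ^ (m - 1) := pow_pos (by linarith) _
  nlinarith

/-! ### The uniform law on the sphere and its moments. -/

theorem toSphere_univ_ne_zero {m : ℕ} (hm : 1 ≤ m) :
    (volume : Measure (E m)).toSphere univ ≠ 0 := by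
  have : NeZero m := ⟨by omega⟩
  exact (Measure.measure_univ_ne_zero).mpr (Measure.toSphere_ne_zero _)

theorem isProbabilityMeasure_uniformSphere {m : ℕ} (hm : 1 ≤ m) :
    IsProbabilityMeasure (uniformSphere m) := by
  refine ⟨?_⟩
  rw [uniformSphere, Measure.smul_apply, Measure.map_apply measurable_subtype_coe .univ,
    preimage_univ, smul_eq_mul]
  exact ENNReal.inv_mul_cancel (toSphere_univ_ne_zero hm) (measure_ne_top _ _)

theorem integral_uniformSphere {m : ℕ} (F : E m → ℝ) :
    ∫ s, F s ∂uniformSphere m = ((volume : Measure (E m)).toSphere.real univ)⁻¹ *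
      ∫ σ : sphere (0 : E m) 1, F σ ∂(volume : Measure (E m)).toSphere := by
  rw [uniformSphere, integral_smul_measure,
    (MeasurableEmbedding.subtype_coe isClosed_sphere.measurableSet).integral_map,
    ENNReal.toReal_inv, smul_eq_mul]
  rfl

theorem ae_uniformSphere_norm {m : ℕ} : ∀ᵐ s ∂uniformSphere m, ‖s‖ = 1 := by
  refine Measure.ae_smul_measure ?_ _
  rw [ae_map_iff measurable_subtype_coe.aemeasurable
    (measurableSet_eq_fun measurable_norm measurable_const)]
  exact Filter.Eventually.of_forall fun σ => norm_eq_of_mem_sphere σ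

theorem integrable_uniformSphere {m : ℕ} (hm : 1 ≤ m) {F : E m → ℝ} (hF : Continuous F) :
    Integrable F (uniformSphere m) := by
  have := isProbabilityMeasure_uniformSphere hm
  obtain ⟨C, hC⟩ := (isCompact_sphere (0 : E m) 1).exists_bound_of_continuousOn hF.continuousOn
  refine Integrable.of_bound hF.aestronglyMeasurable C ?_
  filter_upwards [ae_uniformSphere_norm] with s hs using hC s (by simpa using hs)

theorem le_uniformSphere_integral {m : ℕ} (hm : 1 ≤ m) {f : E m → ℝ} (hconv : ConvexOn ℝ univ f)
    (hd : Differentiable ℝ f) {G : E m → ℝ} (hGc : Continuous G) (hG : ∀ y, ‖fderiv ℝ f y‖ ≤ G y)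
    (x y g : E m) {L : ℝ} (hL : 0 ≤ L)
    (hup : ∀ b, f (y + b) ≤ f y + inner ℝ g b + L / 2 * ‖b‖ ^ 2) {μ : ℝ} (hμ : 0 < μ) :
    f x - f y - L * μ ^ 2 / 2 ≤
      m / μ * ∫ s, f (x + μ • s) * inner ℝ s (x - y) ∂uniformSphere m := by
  have hS : 0 < (volume : Measure (E m)).toSphere.real univ :=
    ENNReal.toReal_pos (toSphere_univ_ne_zero hm) (measure_ne_top _ _)
  have key := le_sphere_integral hm hconv hd hGc hG x y g hup hμ
  rw [integral_uniformSphere]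
  have hm0 : (0 : ℝ) < m := by exact_mod_cast hm
  have h1 := mul_le_mul_of_nonneg_left key (show 0 ≤ m / μ *
    ((volume : Measure (E m)).toSphere.real univ)⁻¹ by positivity)
  rw [mul_assoc, mul_assoc, inv_mul_cancel_left₀ hS.ne'] at h1
  refine le_trans ?_ h1
  have h2 : m / μ * ((f x - f y) * μ / m - L * μ ^ 3 / (2 * (m + 2))) =
      f x - f y - L * μ ^ 2 / 2 * (m / (m + 2)) := by
    field_simp
  -- The exact loss is `m/(m+2)` times `L * μ ^ 2 / 2`; the factor is discarded.
  have h3 : (m : ℝ) / (m + 2) ≤ 1 := (div_le_one (by positivity)).mpr (by linarith)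
  have h4 : 0 ≤ L * μ ^ 2 / 2 := by positivity
  rw [h2]
  nlinarith

/-- The sphere inequality for the constants `1` and `-1`, with `L = 0`, gives both signs. -/
theorem integral_inner_uniformSphere {m : ℕ} (hm : 1 ≤ m) (v : E m) :
    ∫ s, inner ℝ s v ∂uniformSphere m = 0 := by
  have hm0 : (0 : ℝ) < m := by exact_mod_cast hm
  have h : ∀ c : ℝ, 0 ≤ m * (c * ∫ s, inner ℝ s v ∂uniformSphere m) := fun c => by
    have := le_uniformSphere_integral hm (f := fun _ => c) (convexOn_const c convex_univ)
      (by fun_prop) (G := fun _ => 0) (by fun_prop) (fun y => by simp) v 0 0 le_rfl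
      (fun b => by simp) one_pos
    simpa [integral_const_mul] using this
  have h1 := h 1
  have h2 := h (-1)
  refine le_antisymm ?_ ?_ <;> by_contra! h0 <;> nlinarith

/-- This is the sphere inequality for the linear function `z ↦ -⟨a, z⟩` at `x = 0`, `y = -a`, with
`L = 0` and `μ = 1`. -/
theorem integral_inner_sq_uniformSphere_le {m : ℕ} (hm : 1 ≤ m) (a : E m) :
    ∫ s, inner ℝ a s ^ 2 ∂uniformSphere m ≤ ‖a‖ ^ 2 / m := by
  have hm0 : (0 : ℝ) < m := by exact_mod_cast hm
  have hlin : ∀ z : E m, HasFDerivAt (fun z : E m => -inner ℝ a z) (-innerSL ℝ a) z := fun z =>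
    (innerSL ℝ a).hasFDerivAt.neg
  have := le_uniformSphere_integral hm (f := fun z => -inner ℝ a z)
    (((-innerSL ℝ a : E m →L[ℝ] ℝ) : E m →ₗ[ℝ] ℝ).convexOn convex_univ)
    (fun z => (hlin z).differentiableAt) (G := fun _ => ‖a‖) (by fun_prop)
    (fun y => by rw [(hlin y).fderiv]; simp) 0 (-a) (-a) le_rfl
    (fun b => by simp [inner_add_right]) one_pos
  have h2 : ∫ s, -inner ℝ a (0 + (1 : ℝ) • s) * inner ℝ s (0 - -a) ∂uniformSphere m =
      -∫ s, inner ℝ a s ^ 2 ∂uniformSphere m := by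
    rw [← integral_neg]
    congr 1 with s
    simp [real_inner_comm a s]
    ring
  rw [h2] at this
  simp at this
  rw [le_div_iff₀ hm0]
  linarith

/-! ### Smoothness and Euclidean projection. -/

/-- A gradient step of length `1/L` lowers `f` by at least `‖∇f‖²/(2L)` and cannot go below `fmin`.
-/
theorem IsC11.sq_norm_gradient_le {m : ℕ} {L : ℝ} (hL : 0 < L) {f : E m → ℝ} (hf : IsC11 L f)
    {fmin : ℝ} (hmin : ∀ x, fmin ≤ f x) (y : E m) :
    ‖gradient f y‖ ^ 2 ≤ 2 * L * (f y - fmin) := by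
  have h1 := (abs_le.mp (hf.2 (y - L⁻¹ • gradient f y) y)).2
  have h2 := hmin (y - L⁻¹ • gradient f y)
  rw [sub_sub_cancel_left, inner_neg_right, real_inner_smul_right, real_inner_self_eq_norm_sq,
    norm_neg, norm_smul, Real.norm_of_nonneg (by positivity)] at h1
  have h3 : L⁻¹ * ‖gradient f y‖ ^ 2 / 2 ≤ f y - fmin := by
    have : L / 2 * (L⁻¹ * ‖gradient f y‖) ^ 2 = L⁻¹ * ‖gradient f y‖ ^ 2 / 2 := by
      field_simp
    linarith
  calc ‖gradient f y‖ ^ 2 = 2 * L * (L⁻¹ * ‖gradient f y‖ ^ 2 / 2) := by field_simp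
    _ ≤ 2 * L * (f y - fmin) := by gcongr

theorem norm_fderiv_eq_norm_gradient {m : ℕ} (f : E m → ℝ) (y : E m) :
    ‖fderiv ℝ f y‖ = ‖gradient f y‖ := by
  simp [gradient]

theorem IsC11.le_add_sq {m : ℕ} {L : ℝ} {f : E m → ℝ} (hf : IsC11 L f) {xstar : E m}
    (hmin : ∀ x, f xstar ≤ f x) (x : E m) : f x ≤ f xstar + L / 2 * ‖x - xstar‖ ^ 2 := by
  have h0 : gradient f xstar = 0 := by
    have : fderiv ℝ f xstar = 0 := IsLocalMin.fderiv_eq_zero (Filter.Eventually.of_forall hmin)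
    simp [gradient, this]
  have := (abs_le.mp (hf.2 x xstar)).2
  rw [h0, inner_zero_left] at this
  linarith

theorem IsProj.inner_le_zero {m : ℕ} {X : Set (E m)} (hX : Convex ℝ X) {z p : E m}
    (hp : IsProj X z p) {y : E m} (hy : y ∈ X) : inner ℝ (z - p) (y - p) ≤ 0 := by
  refine (norm_eq_iInf_iff_real_inner_le_zero hX hp.1).mp ?_ y hy
  have : Nonempty X := ⟨⟨p, hp.1⟩⟩
  refine le_antisymm (le_ciInf fun w => hp.2 w w.2) ?_
  exact ciInf_le ⟨0, by rintro _ ⟨w, rfl⟩; positivity⟩ (⟨p, hp.1⟩ : X)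

/-- Adding the variational inequalities of the two projections, each tested at the other point,
gives `‖p - p'‖² ≤ ⟨z - z', p - p'⟩`; Cauchy–Schwarz finishes. -/
theorem IsProj.norm_sub_le {m : ℕ} {X : Set (E m)} (hX : Convex ℝ X) {z z' p p' : E m}
    (hp : IsProj X z p) (hp' : IsProj X z' p') : ‖p - p'‖ ≤ ‖z - z'‖ := by
  have h1 := hp.inner_le_zero hX hp'.1
  have h2 := hp'.inner_le_zero hX hp.1
  have h3 : inner ℝ (p - p') (p - p') ≤ inner ℝ (z - z') (p - p') := by
    have e1 : inner ℝ (z - p) (p' - p) = -inner ℝ (z - p) (p - p') := by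
      rw [← inner_neg_right, neg_sub]
    have e2 : inner ℝ (z - z') (p - p') = inner ℝ (p - p') (p - p') + inner ℝ (z - p) (p - p') -
        inner ℝ (z' - p') (p - p') := by
      rw [← inner_add_left, ← inner_sub_left]
      congr 1
      abel
    linarith
  rw [real_inner_self_eq_norm_sq] at h3
  have h4 := real_inner_le_norm (z - z') (p - p')
  by_contra! h
  nlinarith [norm_nonneg (p - p'), norm_nonneg (z - z')]

theorem continuous_euclProj {m : ℕ} {X : Set (E m)} (hX : Convex ℝ X) (hc : IsClosed X)
    (hne : X.Nonempty) : Continuous (euclProj X) := by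
  refine (LipschitzWith.of_dist_le_mul (K := 1) fun z z' => ?_).continuous
  rw [dist_eq_norm, dist_eq_norm, NNReal.coe_one, one_mul]
  exact (euclProj_spec hc hne z).norm_sub_le hX (euclProj_spec hc hne z')

theorem norm_euclProj_sub_le {m : ℕ} {X : Set (E m)} (hX : Convex ℝ X) (hc : IsClosed X)
    (z : E m) {y : E m} (hy : y ∈ X) : ‖euclProj X z - y‖ ≤ ‖z - y‖ :=
  (euclProj_spec hc ⟨y, hy⟩ z).norm_sub_le hX ⟨hy, fun w _ => by simp⟩

/-! ### Bias and second moment of the oracle; one step of the method. -/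

theorem measurable_oracle {m : ℕ} {fd : E m → ℝ} (hfd : Measurable fd) (μ : ℝ) :
    Measurable fun p : E m × E m => oracle fd μ p.1 p.2 := by
  unfold oracle
  fun_prop

theorem inner_oracle {m : ℕ} (fd : E m → ℝ) (μ : ℝ) (x s v : E m) :
    inner ℝ (oracle fd μ x s) v = m / μ * ((fd (x + μ • s) - fd x) * inner ℝ s v) := by
  rw [oracle, real_inner_smul_left, mul_assoc]

theorem abs_inner_le_of_norm_eq_one {m : ℕ} {s : E m} (hs : ‖s‖ = 1) (v : E m) :
    |inner ℝ s v| ≤ ‖v‖ := by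
  simpa [hs] using abs_real_inner_le_norm s v

theorem integrable_uniformSphere_mul_inner {m : ℕ} (hm : 1 ≤ m) {e : E m → ℝ} (he : Measurable e)
    {δ : ℝ} (hδ : ∀ x, |e x| ≤ δ) (v : E m) :
    Integrable (fun s => e s * inner ℝ s v) (uniformSphere m) := by
  have := isProbabilityMeasure_uniformSphere hm
  refine Integrable.of_bound (by fun_prop) (δ * ‖v‖) ?_
  filter_upwards [ae_uniformSphere_norm] with s hs
  rw [norm_mul]
  exact mul_le_mul (hδ _) (abs_inner_le_of_norm_eq_one hs v) (abs_nonneg _)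
    ((abs_nonneg _).trans (hδ 0))

/-- The subtracted value `f x + err x` does not depend on `s`, so it averages out. Only the error at
`x + μ • s` costs a `δ`. The sphere inequality is used at `y = xstar` with `g = 0`. -/
theorem le_integral_inner_oracle {m : ℕ} (hm : 1 ≤ m) {L δ μ : ℝ} (hL : 0 < L) (hμ : 0 < μ)
    {f : E m → ℝ} (hconv : ConvexOn ℝ univ f) (hf : IsC11 L f) {xstar : E m}
    (hmin : ∀ x, f xstar ≤ f x) {err : E m → ℝ} (herr_meas : Measurable err)
    (herr : ∀ x, |err x| ≤ δ) (x : E m) :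
    Integrable (fun s => inner ℝ (oracle (fun y => f y + err y) μ x s) (x - xstar))
      (uniformSphere m) ∧
    f x - f xstar - L * μ ^ 2 / 2 - m / μ * (δ * ‖x - xstar‖) ≤
      ∫ s, inner ℝ (oracle (fun y => f y + err y) μ x s) (x - xstar) ∂uniformSphere m := by
  have := isProbabilityMeasure_uniformSphere hm
  have hfc := hf.1.continuous
  have hkey := le_uniformSphere_integral hm hconv hf.1 (G := fun y => √(2 * L * (f y - f xstar)))
    (by fun_prop) (fun y => by
      rw [norm_fderiv_eq_norm_gradient]
      exact Real.le_sqrt_of_sq_le (hf.sq_norm_gradient_le hL hmin y)) x xstar 0 hL.le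
    (fun b => by simpa using hf.le_add_sq hmin (xstar + b)) hμ
  have hi1 : Integrable (fun s => f (x + μ • s) * inner ℝ s (x - xstar)) (uniformSphere m) :=
    integrable_uniformSphere hm (by fun_prop)
  have hi2 : Integrable (fun s => err (x + μ • s) * inner ℝ s (x - xstar)) (uniformSphere m) :=
    integrable_uniformSphere_mul_inner hm (by fun_prop) (fun s => herr _) _
  have hi3 : Integrable (fun s : E m => inner ℝ s (x - xstar)) (uniformSphere m) :=
    integrable_uniformSphere hm (by fun_prop)
  have heq : (fun s => inner ℝ (oracle (fun y => f y + err y) μ x s) (x - xstar)) =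
      fun s => m / μ * ((f (x + μ • s) * inner ℝ s (x - xstar) +
        err (x + μ • s) * inner ℝ s (x - xstar)) - (f x + err x) * inner ℝ s (x - xstar)) := by
    ext s
    rw [inner_oracle]
    ring
  have hi12 : Integrable (fun s => f (x + μ • s) * inner ℝ s (x - xstar) +
    err (x + μ • s) * inner ℝ s (x - xstar)) (uniformSphere m) := hi1.add hi2
  rw [heq]
  refine ⟨(hi12.sub (hi3.const_mul _)).const_mul _, ?_⟩
  rw [integral_const_mul, integral_sub hi12 (hi3.const_mul _), integral_add hi1 hi2,
    integral_const_mul, integral_inner_uniformSphere hm, mul_zero, sub_zero, mul_add]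
  have herr_int : -(δ * ‖x - xstar‖) ≤
      ∫ s, err (x + μ • s) * inner ℝ s (x - xstar) ∂uniformSphere m := by
    refine (abs_le.mp ?_).1
    have := norm_integral_le_of_norm_le_const (μ := uniformSphere m)
      (f := fun s => err (x + μ • s) * inner ℝ s (x - xstar)) (C := δ * ‖x - xstar‖) (by
        filter_upwards [ae_uniformSphere_norm] with s hs
        rw [norm_mul]
        exact mul_le_mul (herr _) (abs_inner_le_of_norm_eq_one hs _) (abs_nonneg _)
          ((abs_nonneg _).trans (herr 0)))
    simpa using this
  have hnn : (0 : ℝ) ≤ m / μ := by positivity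
  have := mul_le_mul_of_nonneg_left herr_int hnn
  linarith

theorem sq_norm_oracle_le {m : ℕ} {L δ μ : ℝ} (hμ : 0 < μ)
    {f : E m → ℝ} (hf : IsC11 L f) {err : E m → ℝ} (herr : ∀ x, |err x| ≤ δ) (x : E m)
    {s : E m} (hs : ‖s‖ = 1) :
    ‖oracle (fun y => f y + err y) μ x s‖ ^ 2 ≤
      (m / μ) ^ 2 * (4 * μ ^ 2 * inner ℝ (gradient f x) s ^ 2 + L ^ 2 * μ ^ 4 + 8 * δ ^ 2) := by
  rw [oracle, norm_smul, hs, mul_one, Real.norm_eq_abs, sq_abs, mul_pow]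
  refine mul_le_mul_of_nonneg_left ?_ (by positivity)
  have h1 := abs_le.mp (hf.2 (x + μ • s) x)
  rw [add_sub_cancel_left, real_inner_smul_right, norm_smul, hs, mul_one,
    Real.norm_of_nonneg hμ.le] at h1
  set a := inner ℝ (gradient f x) s
  set r := f (x + μ • s) - f x - μ * a with hr
  have he1 := abs_le.mp (herr (x + μ • s))
  have he2 := abs_le.mp (herr x)
  set e := err (x + μ • s) - err x with he
  have hr2 : r ^ 2 ≤ (L / 2 * μ ^ 2) ^ 2 := sq_le_sq' h1.1 h1.2
  have he3 : e ^ 2 ≤ (2 * δ) ^ 2 := sq_le_sq' (by linarith) (by linarith)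
  have : f (x + μ • s) + err (x + μ • s) - (f x + err x) = μ * a + r + e := by
    rw [hr, he]
    ring
  rw [this]
  -- Here `(μa + r + e)² ≤ 4(μa)² + 4r² + 2e²`, with `4r² ≤ L²μ⁴` and `2e² ≤ 8δ²`.
  nlinarith [sq_nonneg (μ * a - r), sq_nonneg (μ * a + r - e)]

/-- The error accumulated by one step of the method, divided by the step size. -/
noncomputable def stepError (m : ℕ) (L R μ δ : ℝ) : ℝ :=
  μ ^ 2 * L * (m + 8) / 8 + 8 * δ * m * R / μ + δ ^ 2 * m / (L * μ ^ 2)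

theorem integral_step_le {m : ℕ} (hm : 1 ≤ m) {L δ μ R : ℝ} (hL : 0 < L) (hμ : 0 < μ)
    {f : E m → ℝ} (hconv : ConvexOn ℝ univ f) (hf : IsC11 L f) {xstar : E m}
    (hmin : ∀ x, f xstar ≤ f x) {err : E m → ℝ} (herr_meas : Measurable err)
    (herr : ∀ x, |err x| ≤ δ) {X : Set (E m)} (hX : Convex ℝ X) (hXc : IsClosed X)
    (hxs : xstar ∈ X) {x : E m} (hxR : ‖x - xstar‖ ≤ 3 * R) :
    ∫ s, ‖euclProj X (x - (1 / (8 * m * L)) • oracle (fun y => f y + err y) μ x s) - xstar‖ ^ 2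
        ∂uniformSphere m ≤
      ‖x - xstar‖ ^ 2 - 1 / (8 * m * L) * (f x - f xstar) +
        1 / (8 * m * L) * stepError m L R μ δ := by
  have := isProbabilityMeasure_uniformSphere hm
  have hm0 : (0 : ℝ) < m := by exact_mod_cast hm
  have hδ : 0 ≤ δ := (abs_nonneg _).trans (herr 0)
  set h := 1 / (8 * m * L) with hh
  have hh0 : 0 < h := by positivity
  obtain ⟨hi1, hle1⟩ := le_integral_inner_oracle hm hL hμ hconv hf hmin herr_meas herr x
  have hi2 : Integrable (fun s : E m => inner ℝ (gradient f x) s ^ 2) (uniformSphere m) :=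
    integrable_uniformSphere hm (by fun_prop)
  have hsq := integral_inner_sq_uniformSphere_le hm (gradient f x)
  have hgrad := hf.sq_norm_gradient_le hL hmin x
  have hpt : ∀ᵐ s ∂uniformSphere m,
      ‖euclProj X (x - h • oracle (fun y => f y + err y) μ x s) - xstar‖ ^ 2 ≤
        (‖x - xstar‖ ^ 2 + h ^ 2 * (m / μ) ^ 2 * (L ^ 2 * μ ^ 4 + 8 * δ ^ 2)) +
        (h ^ 2 * (m / μ) ^ 2 * (4 * μ ^ 2)) * inner ℝ (gradient f x) s ^ 2 -
        2 * h * inner ℝ (oracle (fun y => f y + err y) μ x s) (x - xstar) := by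
    filter_upwards [ae_uniformSphere_norm] with s hs
    have h1 := norm_euclProj_sub_le hX hXc (x - h • oracle (fun y => f y + err y) μ x s) hxs
    have h2 := pow_le_pow_left₀ (norm_nonneg _) h1 2
    have h3 := sq_norm_oracle_le hμ hf herr x hs
    rw [sub_right_comm, norm_sub_sq_real (x - xstar), real_inner_smul_right, norm_smul,
      Real.norm_of_nonneg hh0.le, mul_pow, real_inner_comm] at h2
    have h4 := mul_le_mul_of_nonneg_left h3 (sq_nonneg h)
    linarith
  have hi3 : Integrable (fun s : E m =>
      (‖x - xstar‖ ^ 2 + h ^ 2 * (m / μ) ^ 2 * (L ^ 2 * μ ^ 4 + 8 * δ ^ 2)) +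
        (h ^ 2 * (m / μ) ^ 2 * (4 * μ ^ 2)) * inner ℝ (gradient f x) s ^ 2) (uniformSphere m) :=
    (integrable_const _).add (hi2.const_mul _)
  refine (integral_mono_of_nonneg (Filter.Eventually.of_forall fun s => by positivity)
    (hi3.sub (hi1.const_mul (2 * h))) hpt).trans ?_
  rw [integral_sub' hi3 (hi1.const_mul (2 * h)), integral_add (integrable_const _) (hi2.const_mul _),
    integral_const_mul, integral_const_mul, integral_const, probReal_univ, one_smul]
  -- The choice `h = 1/(8mL)` makes the gradient part of the second moment at most `h(f x - f*)`,
  -- half of the descent `2h(f x - f*)`.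
  have hbound : (h ^ 2 * (m / μ) ^ 2 * (4 * μ ^ 2)) *
      ∫ s, inner ℝ (gradient f x) s ^ 2 ∂uniformSphere m ≤ h * (f x - f xstar) := by
    calc _ ≤ (h ^ 2 * (m / μ) ^ 2 * (4 * μ ^ 2)) * (2 * L * (f x - f xstar) / m) := by
          refine mul_le_mul_of_nonneg_left (hsq.trans ?_) (by positivity)
          gcongr
      _ = h * (f x - f xstar) := by
          rw [hh]
          field_simp
          ring
  have hnoise : m / μ * (δ * ‖x - xstar‖) ≤ 3 * δ * m * R / μ := by
    calc _ ≤ m / μ * (δ * (3 * R)) := by gcongr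
      _ = _ := by ring
  have hR0 : 0 ≤ R := by linarith [norm_nonneg (x - xstar)]
  -- The three terms of `stepError` collect smoothing bias, oracle noise and second moment. The
  -- noise enters with `4R`, although `‖x - xstar‖ ≤ 3R` would suffice; `hslack` absorbs the
  -- difference.
  have hconst : h ^ 2 * (m / μ) ^ 2 * (L ^ 2 * μ ^ 4 + 8 * δ ^ 2) + 2 * h * (L * μ ^ 2 / 2) +
      2 * h * (4 * δ * m * R / μ) = h * stepError m L R μ δ := by
    rw [hh, stepError]
    field_simp
    ring
  have hslack : 0 ≤ δ * m * R / μ := by positivity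
  have h5 := mul_le_mul_of_nonneg_left hle1 hh0.le
  have h6 := mul_le_mul_of_nonneg_left hnoise hh0.le
  have h7 := mul_nonneg hh0.le hslack
  have e1 : 3 * δ * m * R / μ = 3 * (δ * m * R / μ) := by ring
  have e2 : 4 * δ * m * R / μ = 4 * (δ * m * R / μ) := by ring
  rw [e1] at h6
  rw [e2] at hconst
  linarith

/-! ### Measurability and independence of the iterates. -/

theorem iterates_congr {m : ℕ} (fd : E m → ℝ) (μ h R : ℝ) (x0 : E m) {u u' : ℕ → E m} :
    ∀ {k : ℕ}, (∀ i < k, u i = u' i) → iterates fd μ h R x0 u k = iterates fd μ h R x0 u' k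
  | 0, _ => rfl
  | k + 1, hu => by
    rw [iterates, iterates, iterates_congr fd μ h R x0 fun i hi => hu i (by omega), hu k (by omega)]

theorem iterates_mem_closedBall {m : ℕ} (fd : E m → ℝ) (μ h : ℝ) {R : ℝ} (hR : 0 ≤ R) (x0 : E m)
    (u : ℕ → E m) : ∀ k, iterates fd μ h R x0 u k ∈ closedBall x0 (2 * R)
  | 0 => mem_closedBall_self (by positivity)
  | _ + 1 => (euclProj_spec isClosed_closedBall ⟨x0, mem_closedBall_self (by positivity)⟩ _).1

theorem measurable_step {m : ℕ} {fd : E m → ℝ} (hfd : Measurable fd) (μ h : ℝ) {R : ℝ} (hR : 0 ≤ R)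
    (x0 : E m) : Measurable fun p : E m × E m =>
      euclProj (closedBall x0 (2 * R)) (p.1 - h • oracle fd μ p.1 p.2) :=
  (continuous_euclProj (convex_closedBall _ _) isClosed_closedBall
    ⟨x0, mem_closedBall_self (by positivity)⟩).measurable.comp
    (measurable_fst.sub ((measurable_oracle hfd μ).const_smul h))

theorem measurable_iterates {m : ℕ} {fd : E m → ℝ} (hfd : Measurable fd) (μ h : ℝ) {R : ℝ}
    (hR : 0 ≤ R) (x0 : E m) (k : ℕ) :
    Measurable fun u : ℕ → E m => iterates fd μ h R x0 u k := by
  induction k with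
  | zero => exact measurable_const
  | succ k ih =>
    have := (measurable_step hfd μ h hR x0).comp (ih.prodMk (measurable_pi_apply k))
    simp only [Function.comp_def] at this
    simpa only [iterates] using this

/-- The `k`-th iterate uses only the directions of index below `k`. It therefore factors through
that finite tuple, extended by zeros, which is independent of `s k`. -/
theorem indepFun_iterates {m : ℕ} {fd : E m → ℝ} (hfd : Measurable fd) (μ h : ℝ) {R : ℝ}
    (hR : 0 ≤ R) (x0 : E m) {Ω : Type*} [MeasurableSpace Ω] {P : Measure Ω} {s : ℕ → Ω → E m}
    (hs_meas : ∀ k, Measurable (s k)) (hs_indep : iIndepFun s P) (k : ℕ) :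
    IndepFun (fun ω => iterates fd μ h R x0 (fun i => s i ω) k) (s k) P := by
  have hind := hs_indep.indepFun_finset (Finset.range k) {k} (by simp) hs_meas
  let ext : (Finset.range k → E m) → ℕ → E m := fun w i =>
    if hi : i ∈ Finset.range k then w ⟨i, hi⟩ else 0
  have hext : Measurable ext := by
    refine measurable_pi_lambda _ fun i => ?_
    by_cases hi : i ∈ Finset.range k
    · simp only [ext, hi, dif_pos]
      exact measurable_pi_apply _
    · simp only [ext, hi, dif_neg, not_false_eq_true]
      exact measurable_const
  have := hind.comp ((measurable_iterates hfd μ h hR x0 k).comp hext)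
    (measurable_pi_apply (⟨k, Finset.mem_singleton_self k⟩ : ({k} : Finset ℕ)))
  have heq : (fun ω => iterates fd μ h R x0 (fun i => s i ω) k) =
      ((fun u : ℕ → E m => iterates fd μ h R x0 u k) ∘ ext) ∘
        fun ω (i : Finset.range k) => s i ω := by
    ext1 ω
    refine iterates_congr fd μ h R x0 fun i hi => ?_
    simp [ext, hi]
  rw [heq]
  exact this

theorem integrable_comp_of_mem_closedBall {m : ℕ} {Ω : Type*} [MeasurableSpace Ω] {P : Measure Ω}
    [IsFiniteMeasure P] {F : E m → ℝ} (hF : Continuous F) {X : Ω → E m} (hX : Measurable X)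
    {x0 : E m} {r : ℝ} (hmem : ∀ ω, X ω ∈ closedBall x0 r) : Integrable (fun ω => F (X ω)) P := by
  obtain ⟨C, hC⟩ := (isCompact_closedBall x0 r).exists_bound_of_continuousOn hF.continuousOn
  exact Integrable.of_bound (hF.measurable.comp hX).aestronglyMeasurable C
    (Filter.Eventually.of_forall fun ω => hC _ (hmem ω))

/-! ### Strong convexity, the recursion in expectation and its solutions. -/

theorem IsStronglyConvex.le_of_isC11 {m : ℕ} (hm : 1 ≤ m) {L τ : ℝ} {f : E m → ℝ}
    (hf : IsC11 L f) (hτ : IsStronglyConvex τ f) : τ ≤ L := by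
  have h1 := (abs_le.mp (hf.2 (EuclideanSpace.single ⟨0, hm⟩ 1) 0)).2
  have h2 := hτ (EuclideanSpace.single ⟨0, hm⟩ 1) 0
  have hn : ‖(EuclideanSpace.single ⟨0, hm⟩ 1 : E m)‖ = 1 := by simp
  rw [sub_zero, hn, one_pow] at h1 h2
  linarith

theorem IsStronglyConvex.mul_sq_le {m : ℕ} {τ : ℝ} {f : E m → ℝ} (hτ : IsStronglyConvex τ f)
    {xstar : E m} (hmin : ∀ x, f xstar ≤ f x) (x : E m) :
    τ / 2 * ‖x - xstar‖ ^ 2 ≤ f x - f xstar := by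
  have h0 : gradient f xstar = 0 := by
    have : fderiv ℝ f xstar = 0 := IsLocalMin.fderiv_eq_zero (Filter.Eventually.of_forall hmin)
    simp [gradient, this]
  have := hτ x xstar
  rw [h0, inner_zero_left] at this
  linarith

/-- By independence the law of `(x k, s k)` is a product, so Fubini allows `integral_step_le` to be
applied with the iterate frozen. The `3R` bound holds because iterates stay within `2R` of `x0`. -/
theorem integral_iterates_succ_le {m : ℕ} (hm : 1 ≤ m) {L δ μ R : ℝ} (hL : 0 < L) (hμ : 0 < μ)
    {f : E m → ℝ} (hconv : ConvexOn ℝ univ f) (hf : IsC11 L f) {xstar x0 : E m}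
    (hmin : ∀ x, f xstar ≤ f x) (hR : ‖x0 - xstar‖ ≤ R) {err : E m → ℝ}
    (herr_meas : Measurable err) (herr : ∀ x, |err x| ≤ δ) {Ω : Type*} [MeasurableSpace Ω]
    {P : Measure Ω} [IsProbabilityMeasure P] {s : ℕ → Ω → E m} (hs_meas : ∀ k, Measurable (s k))
    (hs_law : ∀ k, P.map (s k) = uniformSphere m) (hs_indep : iIndepFun s P) (x : ℕ → Ω → E m)
    (hx : ∀ k ω, x k ω = iterates (fun y => f y + err y) μ (1 / (8 * m * L)) R x0
      (fun i => s i ω) k) (k : ℕ) :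
    ∫ ω, ‖x (k + 1) ω - xstar‖ ^ 2 ∂P ≤ ∫ ω, ‖x k ω - xstar‖ ^ 2 ∂P -
      1 / (8 * m * L) * (∫ ω, f (x k ω) ∂P - f xstar) +
        1 / (8 * m * L) * stepError m L R μ δ := by
  have hσ := isProbabilityMeasure_uniformSphere hm
  have hR0 : 0 ≤ R := (norm_nonneg _).trans hR
  have hfc : Continuous f := hf.1.continuous
  have hfd : Measurable fun y => f y + err y := hfc.measurable.add herr_meas
  set h := 1 / (8 * m * L)
  obtain rfl : x = fun k ω => iterates (fun y => f y + err y) μ h R x0 (fun i => s i ω) k := by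
    ext1 k
    ext1 ω
    exact hx k ω
  set x : ℕ → Ω → E m := fun k ω =>
    iterates (fun y => f y + err y) μ h R x0 (fun i => s i ω) k with hxdef
  have hxs : xstar ∈ closedBall x0 (2 * R) := by
    rw [mem_closedBall, dist_comm, dist_eq_norm]
    linarith
  have hmem : ∀ k ω, x k ω ∈ closedBall x0 (2 * R) := fun k ω =>
    iterates_mem_closedBall _ μ h hR0 x0 _ k
  have hdist : ∀ z ∈ closedBall x0 (2 * R), ‖z - xstar‖ ≤ 3 * R := fun z hz => by
    rw [mem_closedBall, dist_eq_norm] at hz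
    calc ‖z - xstar‖ = ‖(z - x0) + (x0 - xstar)‖ := by rw [sub_add_sub_cancel]
      _ ≤ ‖z - x0‖ + ‖x0 - xstar‖ := norm_add_le _ _
      _ ≤ 3 * R := by linarith
  have hxm : ∀ k, Measurable (x k) := fun k =>
    (measurable_iterates hfd μ h hR0 x0 k).comp (measurable_pi_lambda _ hs_meas)
  set F : E m × E m → ℝ := fun p => ‖euclProj (closedBall x0 (2 * R))
    (p.1 - h • oracle (fun y => f y + err y) μ p.1 p.2) - xstar‖ ^ 2 with hF
  have hFm : Measurable F := ((measurable_step hfd μ h hR0 x0).sub_const _).norm.pow_const 2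
  have hprod : P.map (fun ω => (x k ω, s k ω)) = (P.map (x k)).prod (uniformSphere m) := by
    rw [← hs_law k]
    exact (indepFun_iff_map_prod_eq_prod_map_map (hxm k).aemeasurable
      (hs_meas k).aemeasurable).mp (indepFun_iterates hfd μ h hR0 x0 hs_meas hs_indep k)
  have hPk : IsProbabilityMeasure (P.map (x k)) :=
    Measure.isProbabilityMeasure_map (hxm k).aemeasurable
  have hFi : Integrable F ((P.map (x k)).prod (uniformSphere m)) := by
    refine Integrable.of_bound hFm.aestronglyMeasurable ((3 * R) ^ 2)
      (Filter.Eventually.of_forall fun p => ?_)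
    rw [Real.norm_of_nonneg (by positivity)]
    exact pow_le_pow_left₀ (norm_nonneg _)
      (hdist _ (euclProj_spec isClosed_closedBall ⟨xstar, hxs⟩ _).1) 2
  have hI1 : Integrable (fun ω => ‖x k ω - xstar‖ ^ 2) P :=
    integrable_comp_of_mem_closedBall (F := fun z => ‖z - xstar‖ ^ 2) (by fun_prop) (hxm k) (hmem k)
  have hI2 : Integrable (fun ω => f (x k ω)) P :=
    integrable_comp_of_mem_closedBall hfc (hxm k) (hmem k)
  have hI3 : Integrable (fun ω => h * (f (x k ω) - f xstar)) P :=
    (hI2.sub (integrable_const _)).const_mul _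
  have hI4 : Integrable (fun ω => ‖x k ω - xstar‖ ^ 2 - h * (f (x k ω) - f xstar)) P := hI1.sub hI3
  calc ∫ ω, ‖x (k + 1) ω - xstar‖ ^ 2 ∂P = ∫ ω, F (x k ω, s k ω) ∂P := rfl
    _ = ∫ p, F p ∂((P.map (x k)).prod (uniformSphere m)) := by
        rw [← hprod, integral_map ((hxm k).prodMk (hs_meas k)).aemeasurable hFm.aestronglyMeasurable]
    _ = ∫ ω, ∫ t, F (x k ω, t) ∂uniformSphere m ∂P := by
        rw [integral_prod _ hFi, integral_map (hxm k).aemeasurable]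
        exact hFi.aestronglyMeasurable.integral_prod_right'
    _ ≤ ∫ ω, (‖x k ω - xstar‖ ^ 2 - h * (f (x k ω) - f xstar) + h * stepError m L R μ δ) ∂P := by
        refine integral_mono_of_nonneg
          (Filter.Eventually.of_forall fun ω => integral_nonneg fun t => by positivity)
          (hI4.add (integrable_const _)) (Filter.Eventually.of_forall fun ω => ?_)
        exact integral_step_le hm hL hμ hconv hf hmin herr_meas herr (convex_closedBall _ _)
          isClosed_closedBall hxs (hdist _ (hmem k ω))
    _ = _ := by
        rw [integral_add hI4 (integrable_const _), integral_sub hI1 hI3, integral_const_mul,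
          integral_sub hI2 (integrable_const _)]
        simp

/-- The distances telescope, and the last one is dropped since it is nonnegative. -/
theorem average_le_of_recursion {h C f : ℝ} (hh : 0 < h) {D ψ : ℕ → ℝ} (hD : ∀ k, 0 ≤ D k)
    (hrec : ∀ k, D (k + 1) ≤ D k - h * (ψ k - f) + h * C) (M : ℕ) :
    1 / ((M : ℝ) + 1) * ∑ i ∈ Finset.range (M + 1), (ψ i - f) ≤ D 0 / h / (M + 1) + C := by
  have hsum : ∀ n : ℕ, h * ∑ i ∈ Finset.range n, (ψ i - f) ≤ D 0 - D n + n * (h * C) := by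
    intro n
    induction n with
    | zero => simp
    | succ n ih =>
      rw [Finset.sum_range_succ, mul_add]
      push_cast
      linarith [hrec n]
  have h1 := hsum (M + 1)
  have h2 := hD (M + 1)
  push_cast at h1
  have hM : (0 : ℝ) < M + 1 := by positivity
  have h3 : ∑ i ∈ Finset.range (M + 1), (ψ i - f) ≤ (D 0 + (M + 1) * (h * C)) / h := by
    rw [le_div_iff₀ hh]
    linarith
  calc _ ≤ 1 / ((M : ℝ) + 1) * ((D 0 + (M + 1) * (h * C)) / h) := by gcongr
    _ = _ := by field_simp

theorem sub_le_geometric_of_recursion {q d : ℝ} (hq : 0 ≤ q) {D : ℕ → ℝ}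
    (hrec : ∀ k, D (k + 1) - d ≤ q * (D k - d)) (M : ℕ) : D M - d ≤ q ^ M * (D 0 - d) := by
  induction M with
  | zero => simp
  | succ n ih =>
    rw [pow_succ', mul_assoc]
    exact (hrec n).trans (mul_le_mul_of_nonneg_left ih hq)

end GradFree

open GradFree in
theorem theorem1 {m : ℕ} (hm : 1 ≤ m) {L δ μ R : ℝ} (hL : 0 < L) (hμ : 0 < μ)
    -- the objective function, a minimizer of it, and the starting point
    (f : GradFree.E m → ℝ) (hconv : ConvexOn ℝ Set.univ f) (hf : GradFree.IsC11 L f)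
    (xstar x0 : GradFree.E m) (hmin : ∀ x, f xstar ≤ f x) (hR : ‖x0 - xstar‖ ≤ R)
    -- the error of the zeroth-order oracle
    (err : GradFree.E m → ℝ) (herr_meas : Measurable err) (herr : ∀ x, |err x| ≤ δ)
    -- the independent random directions, uniformly distributed over the unit sphere
    {Ω : Type*} [MeasurableSpace Ω] (P : Measure Ω) [IsProbabilityMeasure P]
    (s : ℕ → Ω → GradFree.E m) (hs_meas : ∀ k, Measurable (s k))
    (hs_law : ∀ k, P.map (s k) = GradFree.uniformSphere m) (hs_indep : iIndepFun s P)
    -- the iterates and the expected values of the objective function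
    (x : ℕ → Ω → GradFree.E m)
    (hx : ∀ k ω, x k ω = GradFree.iterates (fun y => f y + err y) μ (1 / (8 * m * L)) R x0
      (fun i => s i ω) k)
    (ψ : ℕ → ℝ) (hψ : ∀ k, ψ k = ∫ ω, f (x k ω) ∂P) :
    (∀ k, Integrable (fun ω => f (x k ω)) P) ∧
    (∀ M : ℕ, 1 / ((M : ℝ) + 1) * ∑ i ∈ Finset.range (M + 1), (ψ i - f xstar) ≤
      8 * m * L * R ^ 2 / (M + 1) + μ ^ 2 * L * (m + 8) / 8 + 8 * δ * m * R / μ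
        + δ ^ 2 * m / (L * μ ^ 2)) ∧
    (∀ τ : ℝ, 0 < τ → GradFree.IsStronglyConvex τ f → ∀ M : ℕ,
      ψ M - f xstar ≤ 1 / 2 * L * (GradFree.deltaMu m L R τ μ δ
        + (1 - τ / (16 * m * L)) ^ M * (R ^ 2 - GradFree.deltaMu m L R τ μ δ))) := by
  have hm0 : (0 : ℝ) < m := by exact_mod_cast hm
  have hm1 : (1 : ℝ) ≤ m := by exact_mod_cast hm
  have hR0 : 0 ≤ R := (norm_nonneg _).trans hR
  have hfc : Continuous f := hf.1.continuous
  have hfd : Measurable fun y => f y + err y := hfc.measurable.add herr_meas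
  have hmem : ∀ k ω, x k ω ∈ Metric.closedBall x0 (2 * R) := fun k ω => by
    rw [hx]
    exact iterates_mem_closedBall _ _ _ hR0 x0 _ k
  have hxm : ∀ k, Measurable (x k) := fun k => by
    rw [funext (hx k)]
    exact (measurable_iterates hfd μ _ hR0 x0 k).comp (measurable_pi_lambda _ hs_meas)
  have hint : ∀ k, Integrable (fun ω => f (x k ω)) P := fun k =>
    integrable_comp_of_mem_closedBall hfc (hxm k) (hmem k)
  have hintD : ∀ k, Integrable (fun ω => ‖x k ω - xstar‖ ^ 2) P := fun k =>
    integrable_comp_of_mem_closedBall (F := fun z => ‖z - xstar‖ ^ 2) (by fun_prop) (hxm k) (hmem k)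
  set D : ℕ → ℝ := fun k => ∫ ω, ‖x k ω - xstar‖ ^ 2 ∂P with hDdef
  have hD : ∀ k, 0 ≤ D k := fun k => integral_nonneg fun ω => by positivity
  have hD0 : D 0 ≤ R ^ 2 := by
    have : D 0 = ‖x0 - xstar‖ ^ 2 := by simp [hDdef, hx, iterates]
    rw [this]
    gcongr
  have hh : (0 : ℝ) < 1 / (8 * m * L) := by positivity
  have hrec : ∀ k, D (k + 1) ≤ D k - 1 / (8 * m * L) * (ψ k - f xstar) +
      1 / (8 * m * L) * stepError m L R μ δ := fun k => by
    rw [hψ]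
    exact integral_iterates_succ_le hm hL hμ hconv hf hmin hR herr_meas herr hs_meas hs_law
      hs_indep x hx k
  refine ⟨hint, fun M => ?_, fun τ hτ hsc M => ?_⟩
  · refine (average_le_of_recursion hh hD hrec M).trans ?_
    have h1 : D 0 / (1 / (8 * m * L)) / ((M : ℝ) + 1) ≤ 8 * m * L * R ^ 2 / (M + 1) := by
      rw [div_div_eq_mul_div, div_one, mul_comm]
      gcongr
    rw [stepError]
    linarith
  · have hτL := hsc.le_of_isC11 hm hf
    have hq : 0 ≤ 1 - τ / (16 * m * L) := by
      rw [sub_nonneg, div_le_one (by positivity)]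
      -- From `τ ≤ L` and `1 ≤ m` follows `τ ≤ 16 * m * L`, so powers of the contraction factor are
      -- nonnegative.
      nlinarith
    have hψD : ∀ k, τ / 2 * D k ≤ ψ k - f xstar := fun k => by
      rw [hψ, hDdef, ← integral_const_mul]
      have := integral_mono ((hintD k).const_mul (τ / 2)) ((hint k).sub (integrable_const (f xstar)))
        fun ω => hsc.mul_sq_le hmin (x k ω)
      rw [integral_sub' (hint k) (integrable_const _)] at this
      simpa using this
    have hψL : ψ M - f xstar ≤ L / 2 * D M := by
      rw [hψ, hDdef, ← integral_const_mul]
      have := integral_mono ((hint M).sub (integrable_const (f xstar))) ((hintD M).const_mul (L / 2))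
        fun ω => sub_le_iff_le_add'.mpr (hf.le_add_sq hmin (x M ω))
      rw [integral_sub' (hint M) (integrable_const _)] at this
      simpa using this
    -- Thus `deltaMu` is the fixed point of the recursion `D ↦ (1 - τ/(16mL)) D + h * stepError`
    -- produced by `f - f* ≥ (τ/2)‖x - x*‖²`.
    have hdelta : 1 / (8 * m * L) * stepError m L R μ δ =
        τ / (16 * m * L) * deltaMu m L R τ μ δ := by
      rw [stepError, deltaMu]
      field_simp
      ring
    have hgeo := sub_le_geometric_of_recursion (D := D) (d := deltaMu m L R τ μ δ) hq (fun k => by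
      have h1 := hrec k
      have h2 := mul_le_mul_of_nonneg_left (hψD k) hh.le
      have h3 : 1 / (8 * m * L) * (τ / 2 * D k) = τ / (16 * m * L) * D k := by
        field_simp
        ring
      rw [hdelta] at h1
      linarith) M
    have h4 : (1 - τ / (16 * m * L)) ^ M * (D 0 - deltaMu m L R τ μ δ) ≤
        (1 - τ / (16 * m * L)) ^ M * (R ^ 2 - deltaMu m L R τ μ δ) :=
      mul_le_mul_of_nonneg_left (by linarith) (pow_nonneg hq M)
    have h5 := mul_le_mul_of_nonneg_left (hgeo.trans h4) (show 0 ≤ L / 2 by positivity)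
    linarith
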